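/- For every non-negative integer $k\equiv 2 \pmod{15}$, the number \[ n=\frac{512k^5+1280k^4+6080k^3+7840k^2+10010k+3741}{3125} \] is a positive integer and there is an undirected Cayley graph of the cyclic group $\mathbb{Z}_n$ on five generators (a circulant graph) that has order $n$, degree $10$ and diameter exactly $k$. Moreover, a generating set for which this holds is $\{g_1,\dots,g_5\}$, where $g_1,\dots,g_5$ are the following numbers, all of which are integers, reduced modulo $n$: \[ \begin{aligned} g_1&=1,\\ g_2&=\frac{128k^4+256k^3+1192k^2+1064k+883}{625},\\ g_3&=\frac{512k^5+640k^4+4000k^3-1320k^2-6660k-11899}{9375},\\ g_4&=\frac{512k^5+640k^4+4000k^3-1320k^2+840k-8149}{9375},\\ g_5&=\frac{512k^5+640k^4+6400k^3+2280k^2+13890k-2224}{9375}. \end{aligned} \] That is, the graph with vertex set $\mathbb{Z}_n$ in which $u$ and $v$ are adjacent if and only if $u-v\in\{\pm g_1,\dots,\pm g_5\}$ is connected, every vertex has exactly $10$ neighbours, and its diameter is $k$. -/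

import Mathlib

/-- The undirected Cayley graph of the cyclic group `ℤ/nℤ` on the generators `g 0, …, g 4`
(reduced modulo `n`): distinct `u`, `v` are adjacent iff `u - v` or `v - u` is some `g i`.
The connection set is thus `{± g i}`. -/
def circulantOnFive (n : ℕ) (g : Fin 5 → ℤ) : SimpleGraph (ZMod n) :=
  SimpleGraph.circulantGraph (Set.range fun i => (g i : ZMod n))

/-! Write `k = 15v + 2` and `m = 6v + 1`. The integer vectors `x` with `∑ xᵢ gᵢ ≡ 0` mod `n` form a
lattice `L`, and the diameter of the graph is the `ℓ¹` covering radius of `L` in `ℤ⁵`. By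
`inLattice_iff`, `L` is the union of the row lattice of `A = 2m + E` and its translate by `h`, half
the sum of the rows. Here `E` is skew-symmetric with entries `0, ±1`, supported on the bowtie (two
triangles sharing a vertex).

Upper bound (`covering`, for `v ≥ 1`): reduce `x` to an `ℓ¹`-minimal vector modulo the rows of `A`.
Changing the sign of a coordinate only changes signs in `E`, so `x ≥ 0` may be assumed. Minimality
then puts `x` in the box between `0` and some half vector `w`, half of a signed sum of the rows
(`exists_signs_of_minimal`). Every half vector lies in `h + A ℤ⁵`, and skew-symmetry gives `|w| =
5m`. Hence `|x| + |x - w| = 5m`, and one of the two summands is at most `5m/2 = 15v + 5/2`;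
integrality gives `k`.

Lower bound (`le_sum_abs_sub_of_inLattice`, for `v ≥ 1`): an explicit vector of norm `k` has
distance at least `k` from both cosets, because its coordinates, and those of its reflection `h -
x`, are at most `m - 2`.

The case `v = 0`, with `n = 45` and `k = 2`, is a finite check. -/

/-! ### Combinatorial choice of signs on the bowtie. -/

/-- The change of `|y|` under the shift `y ↦ y - u`, for `y ≥ 0` and `|u| ≤ 1`. -/
def absShift (y u : ℤ) : ℤ := if y = 0 then |u| else -u

theorem neg_eq_one_or {u : ℤ} (hu : u = 1 ∨ u = -1) : -u = 1 ∨ -u = -1 := by omega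

theorem absShift_zero {u : ℤ} (hu : u = 1 ∨ u = -1) : absShift 0 u = 1 := by
  rcases hu with rfl | rfl <;> simp [absShift]

theorem absShift_pos {y : ℤ} (hy : 0 < y) (u : ℤ) : absShift y u = -u := by
  simp [absShift, hy.ne']

/-- Signs for one triangle of the bowtie when the coordinate of its central vertex is positive. -/
theorem exists_signs_triangle {m q r a b c : ℤ} (hq : 0 ≤ q) (hr : 0 ≤ r)
    (ha : a = 1 ∨ a = -1) (hb : b = 1 ∨ b = -1) (hc : c = 1 ∨ c = -1)
    (Fq : 2 * q ≤ 2 * m + a + absShift r c) (Fr : 2 * r ≤ 2 * m + b + absShift q (-c)) :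
    ∃ Q R : ℤ, (Q = 1 ∨ Q = -1) ∧ (R = 1 ∨ R = -1) ∧
      (q = 0 ∨ Q = 1 ∧ 2 * q ≤ 2 * m + a - c * R) ∧
      (r = 0 ∨ R = 1 ∧ 2 * r ≤ 2 * m + b + c * Q) ∧
      (-(a * Q + b * R) = absShift q a + absShift r b ∨
        b + c = 0 ∧ -(a * Q + b * R) = 2 * m - 2 * q ∨
        a - c = 0 ∧ -(a * Q + b * R) = 2 * m - 2 * r) := by
  have nc : -c = 1 ∨ -c = -1 := by omega
  rcases hq.eq_or_lt with rfl | hq <;> rcases hr.eq_or_lt with rfl | hr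
  · refine ⟨-a, -b, by omega, by omega, by simp, by simp, .inl ?_⟩
    rw [absShift_zero ha, absShift_zero hb]
    rcases ha with rfl | rfl <;> rcases hb with rfl | rfl <;> norm_num
  · rw [absShift_zero nc] at Fr
    rw [absShift_zero ha, absShift_pos hr]
    by_cases h : 2 * r ≤ 2 * m + b + c * (-a)
    · refine ⟨-a, 1, by omega, by simp, by simp, .inr ⟨rfl, h⟩, .inl ?_⟩
      rcases ha with rfl | rfl <;> omega
    -- The sign `-a`, best for the central coordinate, violates the constraint at `r`. By parity
    -- this forces `a = c` and `2r = 2m + b + 1`, so the other sign contributes exactly `2m - 2r`.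
    · refine ⟨a, 1, by omega, by simp, by simp, .inr ⟨rfl, ?_⟩, ?_⟩ <;>
      rcases ha with rfl | rfl <;> rcases hb with rfl | rfl <;> rcases hc with rfl | rfl <;> omega
  · rw [absShift_zero hc] at Fq
    rw [absShift_zero hb, absShift_pos hq]
    by_cases h : 2 * q ≤ 2 * m + a - c * (-b)
    · refine ⟨1, -b, by simp, by omega, .inr ⟨rfl, h⟩, by simp, .inl ?_⟩
      rcases hb with rfl | rfl <;> omega
    · refine ⟨1, b, by simp, by omega, .inr ⟨rfl, ?_⟩, by simp, ?_⟩ <;>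
      rcases ha with rfl | rfl <;> rcases hb with rfl | rfl <;> rcases hc with rfl | rfl <;> omega
  · rw [absShift_pos hr] at Fq
    rw [absShift_pos hq] at Fr
    refine ⟨1, 1, by simp, by simp, .inr ⟨rfl, by omega⟩, .inr ⟨rfl, by omega⟩, .inl ?_⟩
    rw [absShift_pos hq, absShift_pos hr]; ring

/-- A sign satisfying four constraints on it exists as soon as no two of them exclude each
other. -/
theorem exists_sign_of_pairwise {a b d e u v w z : ℤ}
    (ha : a = 1 ∨ a = -1) (hb : b = 1 ∨ b = -1) (hd : d = 1 ∨ d = -1) (he : e = 1 ∨ e = -1)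
    (hu : u ≤ 0) (hv : v ≤ 0) (hw : w ≤ 0) (hz : z ≤ 0)
    (huv : a + b = 0 → u + v ≤ -1) (huw : a + d = 0 → u + w ≤ -1) (huz : a + e = 0 → u + z ≤ -1)
    (hvw : b + d = 0 → v + w ≤ -1) (hvz : b + e = 0 → v + z ≤ -1) (hwz : d + e = 0 → w + z ≤ -1) :
    ∃ P : ℤ, (P = 1 ∨ P = -1) ∧ 2 * u + 1 ≤ a * P ∧ 2 * v + 1 ≤ b * P ∧ 2 * w + 1 ≤ d * P ∧
      2 * z + 1 ≤ e * P := by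
  by_cases h : 2 * u + 1 ≤ a ∧ 2 * v + 1 ≤ b ∧ 2 * w + 1 ≤ d ∧ 2 * z + 1 ≤ e
  · exact ⟨1, by simp, by simpa using h⟩
  · refine ⟨-1, by simp, ?_⟩
    rcases ha with rfl | rfl <;> rcases hb with rfl | rfl <;> rcases hd with rfl | rfl <;>
    rcases he with rfl | rfl <;> norm_num at * <;> omega

/-- `absShift r c` is odd, and is the contribution `-c * R` of the best sign `R` for `r`. -/
theorem exists_eq_two_mul_add {r c : ℤ} (hr : 0 ≤ r) (hc : c = 1 ∨ c = -1) :
    ∃ g : ℤ, absShift r c = 2 * g + 1 ∧ -(c * if r = 0 then -c else 1) = 2 * g + 1 := by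
  rcases hr.eq_or_lt with rfl | hr
  · rw [absShift_zero hc]; rcases hc with rfl | rfl <;> exact ⟨0, by norm_num⟩
  · rw [absShift_pos hr, if_neg hr.ne']
    rcases hc with rfl | rfl
    · exact ⟨-1, by norm_num⟩
    · exact ⟨0, by norm_num⟩

theorem ite_one_or {u : ℤ} {p : Prop} [Decidable p] (hu : u = 1 ∨ u = -1) :
    (if p then u else 1) = 1 ∨ (if p then u else 1) = -1 := by
  split_ifs <;> simp [hu]

/-- Signs for the bowtie: two triangles `p, q, r` and `p, s, t` with common vertex `p`. -/
theorem exists_signs {m p q r s t a b c d e f : ℤ}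
    (hp : 0 ≤ p) (hq : 0 ≤ q) (hr : 0 ≤ r) (hs : 0 ≤ s) (ht : 0 ≤ t)
    (ha : a = 1 ∨ a = -1) (hb : b = 1 ∨ b = -1) (hc : c = 1 ∨ c = -1)
    (hd : d = 1 ∨ d = -1) (he : e = 1 ∨ e = -1) (hf : f = 1 ∨ f = -1)
    (Fp : 2 * p ≤ 2 * m + absShift q a + absShift r b + absShift s d + absShift t e)
    (Fq : 2 * q ≤ 2 * m + absShift p (-a) + absShift r c)
    (Fr : 2 * r ≤ 2 * m + absShift p (-b) + absShift q (-c))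
    (Fs : 2 * s ≤ 2 * m + absShift p (-d) + absShift t f)
    (Ft : 2 * t ≤ 2 * m + absShift p (-e) + absShift s (-f))
    (Fpq : b + c = 0 → 2 * p + 2 * q ≤ 4 * m + absShift s d + absShift t e)
    (Fpr : a - c = 0 → 2 * p + 2 * r ≤ 4 * m + absShift s d + absShift t e)
    (Fps : e + f = 0 → 2 * p + 2 * s ≤ 4 * m + absShift q a + absShift r b)
    (Fpt : d - f = 0 → 2 * p + 2 * t ≤ 4 * m + absShift q a + absShift r b)
    (Fqr : a + b = 0 → 2 * q + 2 * r ≤ 4 * m)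
    (Fst : d + e = 0 → 2 * s + 2 * t ≤ 4 * m)
    (Fqs : a + d = 0 → 2 * q + 2 * s ≤ 4 * m + absShift r c + absShift t f)
    (Fqt : a + e = 0 → 2 * q + 2 * t ≤ 4 * m + absShift r c + absShift s (-f))
    (Frs : b + d = 0 → 2 * r + 2 * s ≤ 4 * m + absShift q (-c) + absShift t f)
    (Frt : b + e = 0 → 2 * r + 2 * t ≤ 4 * m + absShift q (-c) + absShift s (-f))
    (Fpqs : b + c = 0 → e + f = 0 → 2 * p + 2 * q + 2 * s ≤ 6 * m)
    (Fpqt : b + c = 0 → d - f = 0 → 2 * p + 2 * q + 2 * t ≤ 6 * m)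
    (Fprs : a - c = 0 → e + f = 0 → 2 * p + 2 * r + 2 * s ≤ 6 * m)
    (Fprt : a - c = 0 → d - f = 0 → 2 * p + 2 * r + 2 * t ≤ 6 * m) :
    ∃ P Q R S T : ℤ, (P = 1 ∨ P = -1) ∧ (Q = 1 ∨ Q = -1) ∧ (R = 1 ∨ R = -1) ∧
      (S = 1 ∨ S = -1) ∧ (T = 1 ∨ T = -1) ∧
      (p = 0 ∨ P = 1 ∧ 2 * p ≤ 2 * m - (a * Q + b * R + d * S + e * T)) ∧
      (q = 0 ∨ Q = 1 ∧ 2 * q ≤ 2 * m + a * P - c * R) ∧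
      (r = 0 ∨ R = 1 ∧ 2 * r ≤ 2 * m + b * P + c * Q) ∧
      (s = 0 ∨ S = 1 ∧ 2 * s ≤ 2 * m + d * P - f * T) ∧
      (t = 0 ∨ T = 1 ∧ 2 * t ≤ 2 * m + e * P + f * S) := by
  rcases hp.eq_or_lt with rfl | hp
  · rw [absShift_zero (neg_eq_one_or ha)] at Fq
    rw [absShift_zero (neg_eq_one_or hb)] at Fr
    rw [absShift_zero (neg_eq_one_or hd)] at Fs
    rw [absShift_zero (neg_eq_one_or he)] at Ft
    obtain ⟨gr, hgr, hgr'⟩ := exists_eq_two_mul_add hr hc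
    obtain ⟨gq, hgq, hgq'⟩ := exists_eq_two_mul_add (c := -c) hq (neg_eq_one_or hc)
    obtain ⟨gt, hgt, hgt'⟩ := exists_eq_two_mul_add ht hf
    obtain ⟨gs, hgs, hgs'⟩ := exists_eq_two_mul_add (c := -f) hs (neg_eq_one_or hf)
    have hqr : q = 0 ∨ r = 0 ∨ gr + gq = -1 := by
      rcases hq.eq_or_lt with rfl | hq
      · simp
      rcases hr.eq_or_lt with rfl | hr
      · simp
      rw [absShift_pos hr] at hgr; rw [absShift_pos hq] at hgq; exact .inr (.inr (by linarith))
    have hst : s = 0 ∨ t = 0 ∨ gt + gs = -1 := by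
      rcases hs.eq_or_lt with rfl | hs
      · simp
      rcases ht.eq_or_lt with rfl | ht
      · simp
      rw [absShift_pos ht] at hgt; rw [absShift_pos hs] at hgs; exact .inr (.inr (by linarith))
    rw [hgr] at Fq Fqs Fqt; rw [hgq] at Fr Frs Frt; rw [hgt] at Fs Fqs Frs; rw [hgs] at Ft Fqt Frt
    -- With `p = 0` the sign `P` is free, and the other signs are chosen as good as possible for
    -- their triangle partners. A constraint `2u + 1 ≤ a * P` binds only when `u = 0`; the value
    -- `-1` switches it off at a vanishing coordinate.
    obtain ⟨P, hP, h1, h2, h3, h4⟩ := exists_sign_of_pairwise ha hb hd he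
      (u := if q = 0 then -1 else q - m - gr - 1) (v := if r = 0 then -1 else r - m - gq - 1)
      (w := if s = 0 then -1 else s - m - gt - 1) (z := if t = 0 then -1 else t - m - gs - 1)
      (by split_ifs <;> linarith) (by split_ifs <;> linarith)
      (by split_ifs <;> linarith) (by split_ifs <;> linarith)
      (fun h => by have := Fqr h; rcases hqr with hqr | hqr | hqr <;> split_ifs <;> linarith)
      (fun h => by have := Fqs h; split_ifs <;> linarith)
      (fun h => by have := Fqt h; split_ifs <;> linarith)
      (fun h => by have := Frs h; split_ifs <;> linarith)
      (fun h => by have := Frt h; split_ifs <;> linarith)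
      (fun h => by have := Fst h; rcases hst with hst | hst | hst <;> split_ifs <;> linarith)
    refine ⟨P, if q = 0 then -(-c) else 1, if r = 0 then -c else 1,
      if s = 0 then -(-f) else 1, if t = 0 then -f else 1, hP,
      ite_one_or (by simpa using hc), ite_one_or (neg_eq_one_or hc),
      ite_one_or (by simpa using hf), ite_one_or (neg_eq_one_or hf), .inl rfl, ?_, ?_, ?_, ?_⟩
    · by_cases h : q = 0
      · exact .inl h
      · rw [if_neg h] at h1; exact .inr ⟨if_neg h, by linarith⟩
    · by_cases h : r = 0
      · exact .inl h
      · rw [if_neg h] at h2; exact .inr ⟨if_neg h, by linarith⟩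
    · by_cases h : s = 0
      · exact .inl h
      · rw [if_neg h] at h3; exact .inr ⟨if_neg h, by linarith⟩
    · by_cases h : t = 0
      · exact .inl h
      · rw [if_neg h] at h4; exact .inr ⟨if_neg h, by linarith⟩
  -- With `P = 1` forced, the triangles decouple except in the constraint at `p`. Each triangle
  -- contributes its optimum or an exceptional exact value, and each of the nine combinations is
  -- covered by one minimality inequality.
  · rw [absShift_pos hp, neg_neg] at Fq Fr Fs Ft
    obtain ⟨Q, R, hQ, hR, h1, h2, h3⟩ := exists_signs_triangle hq hr ha hb hc Fq Fr
    obtain ⟨S, T, hS, hT, h4, h5, h6⟩ := exists_signs_triangle hs ht hd he hf Fs Ft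
    refine ⟨1, Q, R, S, T, .inl rfl, hQ, hR, hS, hT, .inr ⟨rfl, ?_⟩, by simpa using h1,
      by simpa using h2, by simpa using h4, by simpa using h5⟩
    rcases h3 with h3 | ⟨k3, h3⟩ | ⟨k3, h3⟩ <;> rcases h6 with h6 | ⟨k6, h6⟩ | ⟨k6, h6⟩
    · linarith
    · linarith [Fps k6]
    · linarith [Fpt k6]
    · linarith [Fpq k3]
    · linarith [Fpqs k3 k6]
    · linarith [Fpqt k3 k6]
    · linarith [Fpr k3]
    · linarith [Fprs k3 k6]
    · linarith [Fprt k3 k6]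

theorem abs_sub_eq_add_absShift {y u : ℤ} (hy : 0 ≤ y) (hu : u = 1 ∨ u = -1) :
    |y - u| = y + absShift y u := by
  rcases hy.eq_or_lt with rfl | hy
  · rw [absShift_zero hu]; rcases hu with rfl | rfl <;> simp
  · rw [absShift_pos hy, abs_of_nonneg (by omega)]; ring

theorem abs_sub_two_mul_add {m y u : ℤ} (hm : 7 ≤ m) (hy : y ≤ m + 2) (hu : u ≤ 2) :
    |y - 2 * m + u| = 2 * m - y - u := by
  rw [abs_of_nonpos (by linarith)]; ring

theorem abs_sub_unit_le {y u : ℤ} (hy : 0 ≤ y) (hu : u = 1 ∨ u = -1) : |y - u| ≤ y + 1 := by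
  rw [abs_le]; omega

theorem le_of_add_le_abs_sub {m y k : ℤ} (hm : 7 ≤ m) (hk : k ≤ 4)
    (h : y ≤ |y - 2 * m| + k) : 2 * y ≤ 2 * m + k := by
  rcases abs_cases (y - 2 * m) with ⟨h', _⟩ | ⟨h', _⟩ <;> omega

theorem unit_le_two {u : ℤ} (hu : u = 1 ∨ u = -1) : u ≤ 2 := by omega

theorem add_unit_le_two {u v : ℤ} (hu : u = 1 ∨ u = -1) (hv : v = 1 ∨ v = -1) : u + v ≤ 2 := by
  omega

/-! ### Minimal vectors lie in half-vector boxes. -/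

/-- A nonnegative vector that is `ℓ¹`-minimal modulo the rows of `2m + E`, with `E` skew-symmetric
on the bowtie graph, lies in one of the boxes spanned by the half vectors, for a suitable choice
of signs at the vanishing coordinates. -/
theorem exists_signs_of_minimal {m p q r s t a b c d e f : ℤ} (hm : 7 ≤ m)
    (hp : 0 ≤ p) (hq : 0 ≤ q) (hr : 0 ≤ r) (hs : 0 ≤ s) (ht : 0 ≤ t)
    (ha : a = 1 ∨ a = -1) (hb : b = 1 ∨ b = -1) (hc : c = 1 ∨ c = -1)
    (hd : d = 1 ∨ d = -1) (he : e = 1 ∨ e = -1) (hf : f = 1 ∨ f = -1)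
    (H : ∀ i j k l n p' q' r' s' t' : ℤ, p' = p - (2 * m * i - a * j - b * k - d * l - e * n) →
      q' = q - (2 * m * j + a * i - c * k) → r' = r - (2 * m * k + b * i + c * j) →
      s' = s - (2 * m * l + d * i - f * n) → t' = t - (2 * m * n + e * i + f * l) →
      p + q + r + s + t ≤ |p'| + |q'| + |r'| + |s'| + |t'|) :
    ∃ P Q R S T : ℤ, (P = 1 ∨ P = -1) ∧ (Q = 1 ∨ Q = -1) ∧ (R = 1 ∨ R = -1) ∧
      (S = 1 ∨ S = -1) ∧ (T = 1 ∨ T = -1) ∧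
      (p = 0 ∨ P = 1 ∧ 2 * p ≤ 2 * m - (a * Q + b * R + d * S + e * T)) ∧
      (q = 0 ∨ Q = 1 ∧ 2 * q ≤ 2 * m + a * P - c * R) ∧
      (r = 0 ∨ R = 1 ∧ 2 * r ≤ 2 * m + b * P + c * Q) ∧
      (s = 0 ∨ S = 1 ∧ 2 * s ≤ 2 * m + d * P - f * T) ∧
      (t = 0 ∨ T = 1 ∧ 2 * t ≤ 2 * m + e * P + f * S) := by
  have na := neg_eq_one_or ha
  have nb := neg_eq_one_or hb
  have nc := neg_eq_one_or hc
  have nd := neg_eq_one_or hd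
  have ne := neg_eq_one_or he
  have nf := neg_eq_one_or hf
  -- These crude bounds fix the sign of every coordinate from which `2m` is subtracted, so the later
  -- absolute values open exactly.
  have bp : p ≤ m + 2 := by
    have := H 1 0 0 0 0 (p - 2 * m) (q - a) (r - b) (s - d) (t - e)
      (by ring) (by ring) (by ring) (by ring) (by ring)
    linarith [le_of_add_le_abs_sub (k := 4) hm (by norm_num) (by
      linarith [abs_sub_unit_le hq ha, abs_sub_unit_le hr hb, abs_sub_unit_le hs hd,
        abs_sub_unit_le ht he] : p ≤ |p - 2 * m| + 4)]
  have bq : q ≤ m + 2 := by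
    have := H 0 1 0 0 0 (p - -a) (q - 2 * m) (r - c) s t
      (by ring) (by ring) (by ring) (by ring) (by ring)
    rw [abs_of_nonneg hs, abs_of_nonneg ht] at this
    linarith [le_of_add_le_abs_sub (k := 2) hm (by norm_num) (by
      linarith [abs_sub_unit_le hp na, abs_sub_unit_le hr hc] : q ≤ |q - 2 * m| + 2)]
  have br : r ≤ m + 2 := by
    have := H 0 0 1 0 0 (p - -b) (q - -c) (r - 2 * m) s t
      (by ring) (by ring) (by ring) (by ring) (by ring)
    rw [abs_of_nonneg hs, abs_of_nonneg ht] at this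
    linarith [le_of_add_le_abs_sub (k := 2) hm (by norm_num) (by
      linarith [abs_sub_unit_le hp nb, abs_sub_unit_le hq nc] : r ≤ |r - 2 * m| + 2)]
  have bs : s ≤ m + 2 := by
    have := H 0 0 0 1 0 (p - -d) q r (s - 2 * m) (t - f)
      (by ring) (by ring) (by ring) (by ring) (by ring)
    rw [abs_of_nonneg hq, abs_of_nonneg hr] at this
    linarith [le_of_add_le_abs_sub (k := 2) hm (by norm_num) (by
      linarith [abs_sub_unit_le hp nd, abs_sub_unit_le ht hf] : s ≤ |s - 2 * m| + 2)]
  have bt : t ≤ m + 2 := by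
    have := H 0 0 0 0 1 (p - -e) q r (s - -f) (t - 2 * m)
      (by ring) (by ring) (by ring) (by ring) (by ring)
    rw [abs_of_nonneg hq, abs_of_nonneg hr] at this
    linarith [le_of_add_le_abs_sub (k := 2) hm (by norm_num) (by
      linarith [abs_sub_unit_le hp ne, abs_sub_unit_le hs nf] : t ≤ |t - 2 * m| + 2)]
  have fp := fun {u : ℤ} (hu : u ≤ 2) => abs_sub_two_mul_add hm bp hu
  have fq := fun {u : ℤ} (hu : u ≤ 2) => abs_sub_two_mul_add hm bq hu
  have fr := fun {u : ℤ} (hu : u ≤ 2) => abs_sub_two_mul_add hm br hu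
  have fs := fun {u : ℤ} (hu : u ≤ 2) => abs_sub_two_mul_add hm bs hu
  have ft := fun {u : ℤ} (hu : u ≤ 2) => abs_sub_two_mul_add hm bt hu
  have z2 : (0 : ℤ) ≤ 2 := by norm_num
  apply exists_signs hp hq hr hs ht ha hb hc hd he hf
  · have := H 1 0 0 0 0 (p - 2 * m + 0) (q - a) (r - b) (s - d) (t - e)
      (by ring) (by ring) (by ring) (by ring) (by ring)
    rw [fp z2, abs_sub_eq_add_absShift hq ha, abs_sub_eq_add_absShift hr hb,
      abs_sub_eq_add_absShift hs hd, abs_sub_eq_add_absShift ht he] at this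
    linarith
  · have := H 0 1 0 0 0 (p - -a) (q - 2 * m + 0) (r - c) s t
      (by ring) (by ring) (by ring) (by ring) (by ring)
    rw [fq z2, abs_sub_eq_add_absShift hp na, abs_sub_eq_add_absShift hr hc,
      abs_of_nonneg hs, abs_of_nonneg ht] at this
    linarith
  · have := H 0 0 1 0 0 (p - -b) (q - -c) (r - 2 * m + 0) s t
      (by ring) (by ring) (by ring) (by ring) (by ring)
    rw [fr z2, abs_sub_eq_add_absShift hp nb, abs_sub_eq_add_absShift hq nc,
      abs_of_nonneg hs, abs_of_nonneg ht] at this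
    linarith
  · have := H 0 0 0 1 0 (p - -d) q r (s - 2 * m + 0) (t - f)
      (by ring) (by ring) (by ring) (by ring) (by ring)
    rw [fs z2, abs_sub_eq_add_absShift hp nd, abs_sub_eq_add_absShift ht hf,
      abs_of_nonneg hq, abs_of_nonneg hr] at this
    linarith
  · have := H 0 0 0 0 1 (p - -e) q r (s - -f) (t - 2 * m + 0)
      (by ring) (by ring) (by ring) (by ring) (by ring)
    rw [ft z2, abs_sub_eq_add_absShift hp ne, abs_sub_eq_add_absShift hs nf,
      abs_of_nonneg hq, abs_of_nonneg hr] at this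
    linarith
  · intro h
    have := H 1 1 0 0 0 (p - 2 * m + a) (q - 2 * m + -a) r (s - d) (t - e)
      (by ring) (by ring) (by linear_combination h) (by ring) (by ring)
    rw [fp (unit_le_two ha), fq (unit_le_two na), abs_of_nonneg hr,
      abs_sub_eq_add_absShift hs hd, abs_sub_eq_add_absShift ht he] at this
    linarith
  · intro h
    have := H 1 0 1 0 0 (p - 2 * m + b) q (r - 2 * m + -b) (s - d) (t - e)
      (by ring) (by linear_combination h) (by ring) (by ring) (by ring)
    rw [fp (unit_le_two hb), fr (unit_le_two nb), abs_of_nonneg hq,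
      abs_sub_eq_add_absShift hs hd, abs_sub_eq_add_absShift ht he] at this
    linarith
  · intro h
    have := H 1 0 0 1 0 (p - 2 * m + d) (q - a) (r - b) (s - 2 * m + -d) t
      (by ring) (by ring) (by ring) (by ring) (by linear_combination h)
    rw [fp (unit_le_two hd), fs (unit_le_two nd), abs_of_nonneg ht,
      abs_sub_eq_add_absShift hq ha, abs_sub_eq_add_absShift hr hb] at this
    linarith
  · intro h
    have := H 1 0 0 0 1 (p - 2 * m + e) (q - a) (r - b) s (t - 2 * m + -e)
      (by ring) (by ring) (by ring) (by linear_combination h) (by ring)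
    rw [fp (unit_le_two he), ft (unit_le_two ne), abs_of_nonneg hs,
      abs_sub_eq_add_absShift hq ha, abs_sub_eq_add_absShift hr hb] at this
    linarith
  · intro h
    have := H 0 1 1 0 0 p (q - 2 * m + c) (r - 2 * m + -c) s t
      (by linear_combination -h) (by ring) (by ring) (by ring) (by ring)
    rw [fq (unit_le_two hc), fr (unit_le_two nc), abs_of_nonneg hp, abs_of_nonneg hs,
      abs_of_nonneg ht] at this
    linarith
  · intro h
    have := H 0 0 0 1 1 p q r (s - 2 * m + f) (t - 2 * m + -f)
      (by linear_combination -h) (by ring) (by ring) (by ring) (by ring)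
    rw [fs (unit_le_two hf), ft (unit_le_two nf), abs_of_nonneg hp, abs_of_nonneg hq,
      abs_of_nonneg hr] at this
    linarith
  · intro h
    have := H 0 1 0 1 0 p (q - 2 * m + 0) (r - c) (s - 2 * m + 0) (t - f)
      (by linear_combination -h) (by ring) (by ring) (by ring) (by ring)
    rw [fq z2, fs z2, abs_of_nonneg hp, abs_sub_eq_add_absShift hr hc,
      abs_sub_eq_add_absShift ht hf] at this
    linarith
  · intro h
    have := H 0 1 0 0 1 p (q - 2 * m + 0) (r - c) (s - -f) (t - 2 * m + 0)
      (by linear_combination -h) (by ring) (by ring) (by ring) (by ring)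
    rw [fq z2, ft z2, abs_of_nonneg hp, abs_sub_eq_add_absShift hr hc,
      abs_sub_eq_add_absShift hs nf] at this
    linarith
  · intro h
    have := H 0 0 1 1 0 p (q - -c) (r - 2 * m + 0) (s - 2 * m + 0) (t - f)
      (by linear_combination -h) (by ring) (by ring) (by ring) (by ring)
    rw [fr z2, fs z2, abs_of_nonneg hp, abs_sub_eq_add_absShift hq nc,
      abs_sub_eq_add_absShift ht hf] at this
    linarith
  · intro h
    have := H 0 0 1 0 1 p (q - -c) (r - 2 * m + 0) (s - -f) (t - 2 * m + 0)
      (by linear_combination -h) (by ring) (by ring) (by ring) (by ring)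
    rw [fr z2, ft z2, abs_of_nonneg hp, abs_sub_eq_add_absShift hq nc,
      abs_sub_eq_add_absShift hs nf] at this
    linarith
  · intro h h'
    have := H 1 1 0 1 0 (p - 2 * m + (a + d)) (q - 2 * m + -a) r (s - 2 * m + -d) t
      (by ring) (by ring) (by linear_combination h) (by ring) (by linear_combination h')
    rw [fp (add_unit_le_two ha hd), fq (unit_le_two na), fs (unit_le_two nd), abs_of_nonneg hr,
      abs_of_nonneg ht] at this
    linarith
  · intro h h'
    have := H 1 1 0 0 1 (p - 2 * m + (a + e)) (q - 2 * m + -a) r s (t - 2 * m + -e)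
      (by ring) (by ring) (by linear_combination h) (by linear_combination h') (by ring)
    rw [fp (add_unit_le_two ha he), fq (unit_le_two na), ft (unit_le_two ne), abs_of_nonneg hr,
      abs_of_nonneg hs] at this
    linarith
  · intro h h'
    have := H 1 0 1 1 0 (p - 2 * m + (b + d)) q (r - 2 * m + -b) (s - 2 * m + -d) t
      (by ring) (by linear_combination h) (by ring) (by ring) (by linear_combination h')
    rw [fp (add_unit_le_two hb hd), fr (unit_le_two nb), fs (unit_le_two nd), abs_of_nonneg hq,
      abs_of_nonneg ht] at this
    linarith
  · intro h h'
    have := H 1 0 1 0 1 (p - 2 * m + (b + e)) q (r - 2 * m + -b) s (t - 2 * m + -e)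
      (by ring) (by linear_combination h) (by ring) (by linear_combination h') (by ring)
    rw [fp (add_unit_le_two hb he), fr (unit_le_two nb), ft (unit_le_two ne), abs_of_nonneg hq,
      abs_of_nonneg hs] at this
    linarith

/-! ### Covering radius: the upper bound. -/

theorem exists_unit_abs_eq (x : ℤ) : ∃ σ : ℤ, (σ = 1 ∨ σ = -1) ∧ |x| = σ * x := by
  rcases abs_choice x with h | h
  · exact ⟨1, .inl rfl, by rw [h, one_mul]⟩
  · exact ⟨-1, .inr rfl, by rw [h]; ring⟩

theorem sq_of_unit {σ : ℤ} (h : σ = 1 ∨ σ = -1) : σ * σ = 1 := by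
  rcases h with rfl | rfl <;> rfl

theorem unit_mul_unit {σ τ : ℤ} (h : σ = 1 ∨ σ = -1) (h' : τ = 1 ∨ τ = -1) :
    σ * τ = 1 ∨ σ * τ = -1 := by
  rcases h with rfl | rfl
  · simpa using h'
  · simpa using neg_eq_one_or h'

theorem abs_unit_mul {σ : ℤ} (h : σ = 1 ∨ σ = -1) (x : ℤ) : |σ * x| = |x| := by
  rcases h with rfl | rfl <;> simp

/-- If `x` lies between `0` and `v` with sign `σ`, the distances to both add up to `|v|`. -/
theorem abs_add_abs_sub {σ x v : ℤ} (h : σ = 1 ∨ σ = -1) (h0 : 0 ≤ σ * x) (h1 : σ * x ≤ σ * v) :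
    |x| + |x - v| = σ * v := by
  rcases h with rfl | rfl
  · rw [abs_of_nonneg (by linarith), abs_of_nonpos (by linarith)]; ring
  · rw [abs_of_nonpos (by linarith), abs_of_nonneg (by linarith)]; ring

theorem unit_mul_sum_le {P σ w x y z : ℤ} (hP : P = 1 ∨ P = -1) (hσ : σ = 1 ∨ σ = -1)
    (hw : |w| ≤ 1) (hx : |x| ≤ 1) (hy : |y| ≤ 1) (hz : |z| ≤ 1) :
    P * (σ * (w + x + y + z)) ≤ 4 := by
  rw [abs_le] at *
  rcases hP with rfl | rfl <;> rcases hσ with rfl | rfl <;> linarith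

/-- `abs_add_abs_sub` for one coordinate of a half vector; signs may be adjusted where `x`
vanishes. -/
theorem abs_add_abs_sub_of_half {m σ P x v w y z u : ℤ} (hm : 7 ≤ m) (hσ : σ = 1 ∨ σ = -1)
    (hP : P = 1 ∨ P = -1) (hx : |x| = σ * x) (hw : |w| ≤ 1) (hy : |y| ≤ 1) (hz : |z| ≤ 1)
    (hu : |u| ≤ 1) (hv : 2 * v = 2 * m * (σ * P) - (w + y + z + u))
    (h : |x| = 0 ∨ P = 1 ∧ 2 * |x| ≤ 2 * m - σ * (w + y + z + u)) :
    |x| + |x - v| = σ * P * v := by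
  have hb := unit_mul_sum_le hP hσ hw hy hz hu
  have key : 2 * (σ * P * v) = 2 * m - P * (σ * (w + y + z + u)) := by
    have h1 := sq_of_unit hσ
    have h2 := sq_of_unit hP
    linear_combination (σ * P) * hv + 2 * m * P * P * h1 + 2 * m * h2
  apply abs_add_abs_sub (unit_mul_unit hσ hP)
  · rcases h with h | ⟨rfl, -⟩
    · rw [abs_eq_zero.1 h, mul_zero]
    · rw [mul_one, ← hx]; exact abs_nonneg x
  · rcases h with h | ⟨rfl, h⟩
    · rw [abs_eq_zero.1 h, mul_zero]; linarith
    · linarith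

theorem abs_unit {σ : ℤ} (h : σ = 1 ∨ σ = -1) : |σ| ≤ 1 := by
  rcases h with rfl | rfl <;> simp

theorem abs_neg_unit {σ : ℤ} (h : σ = 1 ∨ σ = -1) : |-σ| ≤ 1 := by
  rw [abs_neg]; exact abs_unit h

/-- The lattice `A ℤ⁵ ∪ (h + A ℤ⁵)`, where `A = 2m + E` and `h` is half the sum of the rows. -/
def InLattice (m p q r s t : ℤ) : Prop :=
  ∃ i j k l n ε : ℤ, (ε = 0 ∨ ε = 1) ∧ p = 2 * m * i - j - k - l - n + ε * (m - 2) ∧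
    q = 2 * m * j + i - k + ε * m ∧ r = 2 * m * k + i + j + ε * (m + 1) ∧
    s = 2 * m * l + i - n + ε * m ∧ t = 2 * m * n + i + l + ε * (m + 1)

/-- Conjugating `E` by the signs of the coordinates keeps it skew-symmetric on the bowtie, which is
why the sign lemmas allow arbitrary units `a, …, f`. -/
theorem covering_of_minimal {m p q r s t : ℤ} (hm : 7 ≤ m)
    (H : ∀ i j k l n p' q' r' s' t' : ℤ, p' = p - (2 * m * i - j - k - l - n) →
      q' = q - (2 * m * j + i - k) → r' = r - (2 * m * k + i + j) →
      s' = s - (2 * m * l + i - n) → t' = t - (2 * m * n + i + l) →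
      |p| + |q| + |r| + |s| + |t| ≤ |p'| + |q'| + |r'| + |s'| + |t'|) :
    ∃ p' q' r' s' t' : ℤ, InLattice m (p - p') (q - q') (r - r') (s - s') (t - t') ∧
      2 * (|p'| + |q'| + |r'| + |s'| + |t'|) ≤ 5 * m := by
  obtain ⟨σ, hσ, hp⟩ := exists_unit_abs_eq p
  obtain ⟨τ, hτ, hq⟩ := exists_unit_abs_eq q
  obtain ⟨υ, hυ, hr⟩ := exists_unit_abs_eq r
  obtain ⟨φ, hφ, hs⟩ := exists_unit_abs_eq s
  obtain ⟨ψ, hψ, ht⟩ := exists_unit_abs_eq t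
  have sσ := sq_of_unit hσ
  have sτ := sq_of_unit hτ
  have sυ := sq_of_unit hυ
  have sφ := sq_of_unit hφ
  have sψ := sq_of_unit hψ
  obtain ⟨P, Q, R, S, T, hP, hQ, hR, hS, hT, bp, bq, br, bs, bt⟩ :=
    exists_signs_of_minimal hm (abs_nonneg p) (abs_nonneg q) (abs_nonneg r) (abs_nonneg s)
      (abs_nonneg t) (unit_mul_unit hσ hτ) (unit_mul_unit hσ hυ) (unit_mul_unit hτ hυ)
      (unit_mul_unit hσ hφ) (unit_mul_unit hσ hψ) (unit_mul_unit hφ hψ) (by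
        intro i j k l n p' q' r' s' t' h1 h2 h3 h4 h5
        rw [← abs_unit_mul hσ p', ← abs_unit_mul hτ q', ← abs_unit_mul hυ r',
          ← abs_unit_mul hφ s', ← abs_unit_mul hψ t']
        apply H (σ * i) (τ * j) (υ * k) (φ * l) (ψ * n)
        · rw [h1, hp]; linear_combination (p + τ * j + υ * k + φ * l + ψ * n) * sσ
        · rw [h2, hq]; linear_combination (q - σ * i + υ * k) * sτ
        · rw [h3, hr]; linear_combination (r - σ * i - τ * j) * sυ
        · rw [h4, hs]; linear_combination (s - σ * i + ψ * n) * sφ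
        · rw [h5, ht]; linear_combination (t - σ * i - φ * l) * sψ)
  have uσ := unit_mul_unit hσ hP
  have uτ := unit_mul_unit hτ hQ
  have uυ := unit_mul_unit hυ hR
  have uφ := unit_mul_unit hφ hS
  have uψ := unit_mul_unit hψ hT
  -- Writing each sign as `1 + 2i` exhibits the half vector as `h` plus an integral combination of
  -- rows.
  have half : ∀ {u : ℤ}, u = 1 ∨ u = -1 → ∃ i, u = 1 + 2 * i := by
    rintro u (rfl | rfl)
    exacts [⟨0, rfl⟩, ⟨-1, rfl⟩]
  obtain ⟨i, hi⟩ := half uσ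
  obtain ⟨j, hj⟩ := half uτ
  obtain ⟨k, hk⟩ := half uυ
  obtain ⟨l, hl⟩ := half uφ
  obtain ⟨n, hn⟩ := half uψ
  have z1 : |(0 : ℤ)| ≤ 1 := by norm_num
  have ep := abs_add_abs_sub_of_half hm hσ hP hp (abs_unit uτ) (abs_unit uυ) (abs_unit uφ)
    (abs_unit uψ) (v := 2 * m * i - j - k - l - n + 1 * (m - 2))
    (by linear_combination -2 * m * hi + hj + hk + hl + hn)
    (bp.imp_right fun h => ⟨h.1, by linear_combination h.2⟩)
  have eq := abs_add_abs_sub_of_half hm hτ hQ hq (abs_neg_unit uσ) (abs_unit uυ) z1 z1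
    (v := 2 * m * j + i - k + 1 * m)
    (by linear_combination -2 * m * hj - hi + hk)
    (bq.imp_right fun h => ⟨h.1, by linear_combination h.2⟩)
  have er := abs_add_abs_sub_of_half hm hυ hR hr (abs_neg_unit uσ) (abs_neg_unit uτ) z1 z1
    (v := 2 * m * k + i + j + 1 * (m + 1))
    (by linear_combination -2 * m * hk - hi - hj)
    (br.imp_right fun h => ⟨h.1, by linear_combination h.2⟩)
  have es := abs_add_abs_sub_of_half hm hφ hS hs (abs_neg_unit uσ) (abs_unit uψ) z1 z1
    (v := 2 * m * l + i - n + 1 * m)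
    (by linear_combination -2 * m * hl - hi + hn)
    (bs.imp_right fun h => ⟨h.1, by linear_combination h.2⟩)
  have et := abs_add_abs_sub_of_half hm hψ hT ht (abs_neg_unit uσ) (abs_neg_unit uφ) z1 z1
    (v := 2 * m * n + i + l + 1 * (m + 1))
    (by linear_combination -2 * m * hn - hi - hl)
    (bt.imp_right fun h => ⟨h.1, by linear_combination h.2⟩)
  have sp := sq_of_unit uσ
  have sq := sq_of_unit uτ
  have sr := sq_of_unit uυ
  have ss := sq_of_unit uφ
  have st := sq_of_unit uψ
  rw [hi] at ep sp
  rw [hj] at eq sq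
  rw [hk] at er sr
  rw [hl] at es ss
  rw [hn] at et st
  -- The distances from `x` to `0` and to the half vector add up to `5m`, the off-diagonal terms
  -- cancelling by skew-symmetry; the nearer of the two points is taken.
  rcases le_total (2 * (|p| + |q| + |r| + |s| + |t|)) (5 * m) with h | h
  · exact ⟨p, q, r, s, t, ⟨0, 0, 0, 0, 0, 0, .inl rfl, by ring, by ring, by ring, by ring,
      by ring⟩, h⟩
  · refine ⟨_, _, _, _, _, ⟨i, j, k, l, n, 1, .inr rfl, sub_sub_self _ _, sub_sub_self _ _,
      sub_sub_self _ _, sub_sub_self _ _, sub_sub_self _ _⟩, ?_⟩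
    linear_combination 2 * (ep + eq + er + es + et) + 2 * m * (sp + sq + sr + ss + st) + h

/-- Descent on the `ℓ¹` norm: a vector that is not minimal is shortened by a combination of rows. -/
theorem covering {m : ℤ} (hm : 7 ≤ m) (p q r s t : ℤ) :
    ∃ p' q' r' s' t' : ℤ, InLattice m (p - p') (q - q') (r - r') (s - s') (t - t') ∧
      2 * (|p'| + |q'| + |r'| + |s'| + |t'|) ≤ 5 * m := by
  induction h : (|p| + |q| + |r| + |s| + |t|).toNat using Nat.strong_induction_on
    generalizing p q r s t with
  | _ d ih =>
    by_cases H : ∀ i j k l n p' q' r' s' t' : ℤ, p' = p - (2 * m * i - j - k - l - n) →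
      q' = q - (2 * m * j + i - k) → r' = r - (2 * m * k + i + j) →
      s' = s - (2 * m * l + i - n) → t' = t - (2 * m * n + i + l) →
      |p| + |q| + |r| + |s| + |t| ≤ |p'| + |q'| + |r'| + |s'| + |t'|
    · exact covering_of_minimal hm H
    · push Not at H
      obtain ⟨i, j, k, l, n, p₁, q₁, r₁, s₁, t₁, hp, hq, hr, hs, ht, H⟩ := H
      have h0 : 0 ≤ |p₁| + |q₁| + |r₁| + |s₁| + |t₁| := by positivity
      obtain ⟨p', q', r', s', t', ⟨i', j', k', l', n', ε, hε, h1, h2, h3, h4, h5⟩, h'⟩ :=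
        ih _ (by rw [← h]; omega) p₁ q₁ r₁ s₁ t₁ rfl
      exact ⟨p', q', r', s', t', ⟨i + i', j + j', k + k', l + l', n + n', ε, hε,
        by linear_combination h1 - hp, by linear_combination h2 - hq,
        by linear_combination h3 - hr, by linear_combination h4 - hs,
        by linear_combination h5 - ht⟩, h'⟩

/-! ### Covering radius: the lower bound. -/

/-- For `c ≠ 0`, `|x - 2mc| ≥ 2m|c| - x`, and `2x ≤ 2m - 4` leaves a gain of `4|c|`. -/
theorem add_four_mul_abs_sub_le {m x : ℤ} (hm : 2 ≤ m) (h0 : 0 ≤ x) (hx : x ≤ m - 2) (c e : ℤ) :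
    x + 4 * |c| - |e| ≤ |x - 2 * m * c - e| := by
  have h1 : |x - 2 * m * c| - |e| ≤ |x - 2 * m * c - e| := abs_sub_abs_le_abs_sub _ _
  have h2 : x + 4 * |c| ≤ |x - 2 * m * c| := by
    rcases lt_trichotomy c 0 with hc | rfl | hc
    · rw [abs_of_neg hc, abs_of_nonneg (by nlinarith)]; nlinarith
    · simp [abs_of_nonneg h0]
    · rw [abs_of_pos hc, abs_of_nonpos (by nlinarith)]; nlinarith
  linarith

/-- The gain of `4` per unit of each coefficient pays for the perturbation `E`, since each
coefficient occurs in at most four off-diagonal terms. -/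
theorem sum_le_sum_abs_sub_rows {m p q r s t : ℤ} (hm : 2 ≤ m) (hp : 0 ≤ p) (hp' : p ≤ m - 2)
    (hq : 0 ≤ q) (hq' : q ≤ m - 2) (hr : 0 ≤ r) (hr' : r ≤ m - 2) (hs : 0 ≤ s) (hs' : s ≤ m - 2)
    (ht : 0 ≤ t) (ht' : t ≤ m - 2) (i j k l n : ℤ) :
    p + q + r + s + t ≤ |p - 2 * m * i - (-j - k - l - n)| + |q - 2 * m * j - (i - k)| +
      |r - 2 * m * k - (i + j)| + |s - 2 * m * l - (i - n)| + |t - 2 * m * n - (i + l)| := by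
  have h1 := add_four_mul_abs_sub_le hm hp hp' i (-j - k - l - n)
  have h2 := add_four_mul_abs_sub_le hm hq hq' j (i - k)
  have h3 := add_four_mul_abs_sub_le hm hr hr' k (i + j)
  have h4 := add_four_mul_abs_sub_le hm hs hs' l (i - n)
  have h5 := add_four_mul_abs_sub_le hm ht ht' n (i + l)
  have e1 : |-j - k - l - n| ≤ |j| + |k| + |l| + |n| := by
    have a1 := abs_sub (-j - k - l) n
    have a2 := abs_sub (-j - k) l
    have a3 := abs_sub (-j) k
    rw [abs_neg] at a3
    linarith
  linarith [abs_sub i k, abs_add_le i j, abs_sub i n, abs_add_le i l, abs_nonneg i, abs_nonneg j,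
    abs_nonneg k, abs_nonneg l, abs_nonneg n]

/-- The vector `(3v, 3v, 3v, 3v, 3v + 2)` is a deep hole of the lattice. -/
theorem le_sum_abs_sub_of_inLattice {v p q r s t : ℤ} (hv : 1 ≤ v)
    (h : InLattice (6 * v + 1) p q r s t) :
    15 * v + 2 ≤ |3 * v - p| + |3 * v - q| + |3 * v - r| + |3 * v - s| + |3 * v + 2 - t| := by
  obtain ⟨i, j, k, l, n, ε, rfl | rfl, rfl, rfl, rfl, rfl, rfl⟩ := h
  · have := sum_le_sum_abs_sub_rows (m := 6 * v + 1) (p := 3 * v) (q := 3 * v) (r := 3 * v)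
      (s := 3 * v) (t := 3 * v + 2) (by linarith) (by linarith) (by linarith) (by linarith)
      (by linarith) (by linarith) (by linarith) (by linarith) (by linarith) (by linarith)
      (by linarith) i j k l n
    ring_nf at this ⊢
    linarith
  -- The reflection `h - x` of the deep hole turns the translated coset into the row lattice; its
  -- coordinates sum to `15v + 3`.
  · have := sum_le_sum_abs_sub_rows (m := 6 * v + 1) (p := 3 * v - 1) (q := 3 * v + 1)
      (r := 3 * v + 2) (s := 3 * v + 1) (t := 3 * v) (by linarith) (by linarith) (by linarith)
      (by linarith) (by linarith) (by linarith) (by linarith) (by linarith) (by linarith)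
      (by linarith) (by linarith) (-i) (-j) (-k) (-l) (-n)
    rw [← abs_neg (3 * v - _), ← abs_neg (3 * v - _), ← abs_neg (3 * v - _), ← abs_neg (3 * v - _),
      ← abs_neg (3 * v + 2 - _)]
    ring_nf at this ⊢
    linarith

/-! ### The explicit order and generators. -/

/-- The order of the circulant graph of diameter `15v + 2`. -/
def order (v : ℤ) : ℤ :=
  124416 * v ^ 5 + 103680 * v ^ 4 + 39744 * v ^ 3 + 8352 * v ^ 2 + 942 * v + 45

/-- The generators of the circulant graph of diameter `15v + 2`. -/
def generator (v : ℤ) : Fin 5 → ℤ :=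
  ![1, 10368 * v ^ 4 + 6912 * v ^ 3 + 2088 * v ^ 2 + 312 * v + 19,
    41472 * v ^ 5 + 31104 * v ^ 4 + 10656 * v ^ 3 + 1896 * v ^ 2 + 156 * v + 3,
    41472 * v ^ 5 + 31104 * v ^ 4 + 10656 * v ^ 3 + 1896 * v ^ 2 + 168 * v + 5,
    41472 * v ^ 5 + 31104 * v ^ 4 + 11520 * v ^ 3 + 2328 * v ^ 2 + 258 * v + 12]

/-- The lattice is the kernel of `ℤ⁵ → ℤ/nℤ`, `x ↦ ∑ xᵢ gᵢ`. -/
theorem inLattice_iff (v : ℤ) (x : Fin 5 → ℤ) :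
    InLattice (6 * v + 1) (x 3) (x 0) (x 2) (x 1) (x 4) ↔
      order v ∣ ∑ i, x i * generator v i := by
  simp only [Fin.sum_univ_five, generator, order]
  simp only [Matrix.cons_val]
  generalize x 3 = p
  generalize x 0 = q
  generalize x 2 = r
  generalize x 1 = s
  generalize x 4 = t
  constructor
  · rintro ⟨i, j, k, l, n, ε, -, rfl, rfl, rfl, rfl, rfl⟩
    exact ⟨i * (1 + 4 * v) + k * (4 * v) + l + n * (4 * v) + ε * (1 + 6 * v), by ring⟩
  · rintro ⟨z, hz⟩
    -- The coset is read off from a parity: in the forward direction the quotient is congruent to `i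
    -- + l + ε` and `t` to `i + l` mod 2.
    obtain ⟨w, ε, hε, hw⟩ : ∃ w ε : ℤ, (ε = 0 ∨ ε = 1) ∧ z = 2 * w + ε - t :=
      ⟨(z + t) / 2, (z + t) % 2, by omega, by omega⟩
    subst hw
    -- Coefficients solved from `p, r, s, t` and the quotient alone; `q` then follows from `hz`
    -- because its generator is `1`.
    refine ⟨(2 * w + ε - t) * (54 * v + 360 * v ^ 2 + 864 * v ^ 3) + 5 * w + 2 * ε - 3 * t +
        (p + r) * (-10 * v - 96 * v ^ 2 - 288 * v ^ 3) + s * (-1 - 18 * v - 72 * v ^ 2) +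
        t * (-16 * v - 96 * v ^ 2 - 288 * v ^ 3),
      (2 * w + ε - t) * (288 * v + 2016 * v ^ 2 + 6912 * v ^ 3 + 10368 * v ^ 4) + 33 * w + 16 * ε -
        21 * t + p * (-2 - 54 * v - 504 * v ^ 2 - 2016 * v ^ 3 - 3456 * v ^ 4) +
        r * (-1 - 54 * v - 504 * v ^ 2 - 2016 * v ^ 3 - 3456 * v ^ 4) +
        s * (-7 - 90 * v - 432 * v ^ 2 - 864 * v ^ 3) +
        t * (-78 * v - 576 * v ^ 2 - 2016 * v ^ 3 - 3456 * v ^ 4),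
      (2 * w + ε - t) * (-114 * v - 504 * v ^ 2 - 864 * v ^ 3) - 19 * w - 10 * ε + 12 * t +
        (p + r) * (1 + 26 * v + 144 * v ^ 2 + 288 * v ^ 3) + s * (4 + 30 * v + 72 * v ^ 2) +
        t * (32 * v + 144 * v ^ 2 + 288 * v ^ 3),
      (2 * w + ε - t) * (-24 * v - 72 * v ^ 2) - 3 * w - 2 * ε + 2 * t +
        (p + r) * (6 * v + 24 * v ^ 2) + s * (1 + 6 * v) + t * (6 * v + 24 * v ^ 2),
      (2 * w + ε - t) * (-12 * v - 72 * v ^ 2) - w - ε + t +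
        (p + r) * (2 * v + 24 * v ^ 2) + s * (6 * v) + t * (2 * v + 24 * v ^ 2), ε, hε,
      by ring, by linear_combination hz, by ring, by ring, by ring⟩

/-! ### Distances and degrees in the circulant graph. -/

theorem circulantOnFive_adj {n : ℕ} {g : Fin 5 → ℤ} {u w : ZMod n} :
    (circulantOnFive n g).Adj u w ↔
      u ≠ w ∧ ((∃ i, (g i : ZMod n) = u - w) ∨ ∃ i, (g i : ZMod n) = w - u) := by
  simp [circulantOnFive]

theorem edist_add_generator_le (n : ℕ) (g : Fin 5 → ℤ) (u : ZMod n) (i : Fin 5) :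
    (circulantOnFive n g).edist u (u + g i) ≤ 1 := by
  rw [SimpleGraph.edist_le_one_iff_adj_or_eq, circulantOnFive_adj]
  by_cases h : u = u + g i
  · exact .inr h
  · exact .inl ⟨h, .inr ⟨i, by ring⟩⟩

theorem edist_add_nat_mul_le (n : ℕ) (g : Fin 5 → ℤ) (u : ZMod n) (i : Fin 5) (c : ℕ) :
    (circulantOnFive n g).edist u (u + c * g i) ≤ c := by
  induction c with
  | zero => simp
  | succ c ih =>
    refine (SimpleGraph.edist_triangle (v := u + c * g i)).trans ?_
    rw [show u + (c + 1 : ℕ) * (g i : ZMod n) = u + c * g i + g i by push_cast; ring, Nat.cast_add,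
      Nat.cast_one]
    exact add_le_add ih (edist_add_generator_le ..)

theorem edist_add_int_mul_le (n : ℕ) (g : Fin 5 → ℤ) (u : ZMod n) (i : Fin 5) (z : ℤ) :
    (circulantOnFive n g).edist u (u + z * g i) ≤ z.natAbs := by
  rcases Int.eq_nat_or_neg z with ⟨c, rfl | rfl⟩
  · simpa using edist_add_nat_mul_le n g u i c
  · have := edist_add_nat_mul_le n g (u + (-c : ℤ) * g i) i c
    rw [SimpleGraph.edist_comm] at this
    simpa using this

theorem edist_add_sum_le (n : ℕ) (g x : Fin 5 → ℤ) (u : ZMod n) (s : Finset (Fin 5)) :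
    (circulantOnFive n g).edist u (u + ∑ i ∈ s, (x i : ZMod n) * g i) ≤
      (∑ i ∈ s, (x i).natAbs : ℕ) := by
  induction s using Finset.induction_on with
  | empty => simp
  | insert i s hi ih =>
    rw [Finset.sum_insert hi, Finset.sum_insert hi, add_comm (_ * _), ← add_assoc,
      add_comm (Int.natAbs _), Nat.cast_add]
    exact SimpleGraph.edist_triangle.trans (add_le_add ih (edist_add_int_mul_le ..))

theorem sum_abs_single (i : Fin 5) (e : ℤ) : ∑ j, |(Pi.single i e : Fin 5 → ℤ) j| = |e| := by
  rw [Finset.sum_eq_single i (fun j _ hj => by rw [Pi.single_eq_of_ne hj, abs_zero]) (by simp),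
    Pi.single_eq_same]

theorem sum_abs_add_le (x y : Fin 5 → ℤ) : ∑ j, |(x + y) j| ≤ ∑ j, |x j| + ∑ j, |y j| := by
  rw [← Finset.sum_add_distrib]
  exact Finset.sum_le_sum fun j _ => abs_add_le (x j) (y j)

theorem sum_single_mul {R : Type*} [CommRing R] (i : Fin 5) (e : ℤ) (g : Fin 5 → R) :
    ∑ j, (((Pi.single i e : Fin 5 → ℤ) j : ℤ) : R) * g j = e * g i := by
  rw [Finset.sum_eq_single i
    (fun j _ hj => by rw [Pi.single_eq_of_ne hj, Int.cast_zero, zero_mul]) (by simp),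
    Pi.single_eq_same]

theorem exists_sum_of_walk {n : ℕ} {g : Fin 5 → ℤ} {u w : ZMod n}
    (p : (circulantOnFive n g).Walk u w) :
    ∃ x : Fin 5 → ℤ, ∑ i, |x i| ≤ p.length ∧ w = u + ∑ i, (x i : ZMod n) * g i := by
  induction p with
  | nil => exact ⟨0, by simp⟩
  | @cons u v w h p ih =>
    obtain ⟨x, hx, rfl⟩ := ih
    obtain ⟨i, e, he, rfl⟩ : ∃ (i : Fin 5) (e : ℤ), |e| = 1 ∧ v = u + e * g i := by
      rcases (circulantOnFive_adj.1 h).2 with ⟨i, hi⟩ | ⟨i, hi⟩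
      · exact ⟨i, -1, by simp, by rw [hi]; push_cast; ring⟩
      · exact ⟨i, 1, by simp, by rw [hi]; push_cast; ring⟩
    refine ⟨x + Pi.single i e, ?_, ?_⟩
    · refine (sum_abs_add_le _ _).trans ?_
      rw [sum_abs_single, he, SimpleGraph.Walk.length_cons]
      push_cast
      linarith
    · simp only [Pi.add_apply, Int.cast_add, add_mul, Finset.sum_add_distrib, sum_single_mul]
      ring

/-- A walk is a signed sum of generators and conversely, so distances are minimal `ℓ¹` norms of
representations; by translation one residue with no shorter representation than `k` bounds the
diameter below. -/
theorem connected_and_diam_eq {n : ℕ} {g : Fin 5 → ℤ} {k : ℕ}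
    (hcov : ∀ z : ℤ, ∃ x : Fin 5 → ℤ, ∑ i, |x i| ≤ k ∧ (n : ℤ) ∣ z - ∑ i, x i * g i)
    (hdeep : ∃ z : ℤ, ∀ x : Fin 5 → ℤ, (n : ℤ) ∣ z - ∑ i, x i * g i → k ≤ ∑ i, |x i|) :
    (circulantOnFive n g).Connected ∧ (circulantOnFive n g).diam = k := by
  have hle : (circulantOnFive n g).ediam ≤ k := by
    refine SimpleGraph.ediam_le_of_edist_le fun u w => ?_
    obtain ⟨z, hz⟩ := ZMod.intCast_surjective (w - u)
    obtain ⟨x, hx, hd⟩ := hcov z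
    have hw : w = u + ∑ i, (x i : ZMod n) * g i := by
      have := (ZMod.intCast_zmod_eq_zero_iff_dvd _ _).2 hd
      push_cast at this
      rw [hz] at this
      linear_combination this
    rw [hw]
    refine (edist_add_sum_le n g x u Finset.univ).trans ?_
    have : (∑ i, (x i).natAbs : ℕ) ≤ k := by
      zify
      exact hx
    exact_mod_cast this
  have hne : (circulantOnFive n g).ediam ≠ ⊤ := ne_top_of_le_ne_top (by simp) hle
  have hconn := SimpleGraph.connected_of_ediam_ne_top hne
  refine ⟨hconn, ?_⟩
  have hge : (k : ℕ∞) ≤ (circulantOnFive n g).ediam := by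
    obtain ⟨z, hz⟩ := hdeep
    obtain ⟨p, hp⟩ := hconn.exists_walk_length_eq_edist 0 (z : ZMod n)
    obtain ⟨x, hx, hw⟩ := exists_sum_of_walk p
    have := hz x ((ZMod.intCast_zmod_eq_zero_iff_dvd _ _).1 (by push_cast; rw [hw]; ring))
    refine le_trans ?_ (SimpleGraph.edist_le_ediam (u := 0) (v := (z : ZMod n)))
    rw [← hp]
    exact_mod_cast this.trans hx
  rw [SimpleGraph.diam, le_antisymm hle hge, ENat.toNat_natCast]

/-- The ten integers `±gᵢ` are distinct, nonzero and lie strictly between `-n/2` and `n/2`, so they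
stay distinct and nonzero mod `n`. -/
theorem ncard_neighborSet_circulantOnFive {n : ℕ} {g : Fin 5 → ℤ} (hinj : Function.Injective g)
    (hpos : ∀ i, 0 < g i) (hlt : ∀ i, 2 * g i < n) (v : ZMod n) :
    ((circulantOnFive n g).neighborSet v).ncard = 10 := by
  have key : ∀ a b : ℤ, |a - b| < n → (a : ZMod n) = b → a = b := fun a b h hab => by
    have := (ZMod.intCast_eq_intCast_iff_dvd_sub _ _ _).1 hab.symm
    exact sub_eq_zero.1 (Int.eq_zero_of_abs_lt_dvd this h)
  let f : Fin 5 × Bool → ZMod n := fun x => v + ((if x.2 then g x.1 else -g x.1 : ℤ) : ZMod n)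
  have hf : Function.Injective f := by
    rintro ⟨i, b⟩ ⟨j, c⟩ h
    have hi := hpos i
    have hj := hpos j
    have hi' := hlt i
    have hj' := hlt j
    have := key _ _ (by rw [abs_lt]; dsimp only; split_ifs <;> constructor <;> linarith)
      (add_left_cancel h)
    cases b <;> cases c <;> simp at this
    · rw [hinj this]
    · linarith
    · linarith
    · rw [hinj this]
  have hr : (circulantOnFive n g).neighborSet v = Set.range f := by
    ext w
    rw [SimpleGraph.mem_neighborSet, circulantOnFive_adj]
    constructor
    · rintro ⟨-, ⟨i, hi⟩ | ⟨i, hi⟩⟩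
      · exact ⟨(i, false), by simp [f, hi]⟩
      · exact ⟨(i, true), by simp [f, hi]⟩
    · rintro ⟨⟨i, b⟩, rfl⟩
      have h0 : (g i : ZMod n) ≠ 0 := fun h => by
        have := key (g i) 0 (by rw [abs_lt]; constructor <;> linarith [hpos i, hlt i]) (by simpa)
        linarith [hpos i]
      cases b
      · exact ⟨by simp [f, h0], .inl ⟨i, by simp [f]⟩⟩
      · exact ⟨by simp [f, h0], .inr ⟨i, by simp [f]⟩⟩
  rw [hr, ← Set.image_univ, Set.ncard_image_of_injective _ hf, Set.ncard_univ]
  simp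

theorem closure_eq_top_of_eq_one {n : ℕ} {g : Fin 5 → ℤ} (h : g 0 = 1) :
    AddSubgroup.closure (Set.range fun i => (g i : ZMod n)) = ⊤ := by
  rw [eq_top_iff]
  intro z _
  obtain ⟨c, rfl⟩ := ZMod.intCast_surjective z
  have h1 : (1 : ZMod n) ∈ AddSubgroup.closure (Set.range fun i => (g i : ZMod n)) :=
    AddSubgroup.subset_closure ⟨0, by simp [h]⟩
  simpa using AddSubgroup.zsmul_mem _ h1 c

/-! ### Transfer to residues for `v ≥ 1`, and the base case `v = 0`. -/

theorem exists_small_representation {v : ℤ} (hv : 1 ≤ v) (z : ℤ) :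
    ∃ x : Fin 5 → ℤ, ∑ i, |x i| ≤ 15 * v + 2 ∧ order v ∣ z - ∑ i, x i * generator v i := by
  -- The second coordinate belongs to the generator `1`, so this vector represents `z`.
  obtain ⟨p, q, r, s, t, hL, h⟩ := covering (m := 6 * v + 1) (by linarith) 0 z 0 0 0
  refine ⟨![q, s, r, p, t], ?_, ?_⟩
  · simp only [Fin.sum_univ_five, Matrix.cons_val]
    omega
  · convert (inLattice_iff v ![z - q, 0 - s, 0 - r, 0 - p, 0 - t]).1 hL using 1
    simp only [Fin.sum_univ_five, Matrix.cons_val, generator]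
    ring

theorem exists_deep_element {v : ℤ} (hv : 1 ≤ v) :
    ∃ z : ℤ, ∀ x : Fin 5 → ℤ, order v ∣ z - ∑ i, x i * generator v i →
      15 * v + 2 ≤ ∑ i, |x i| := by
  refine ⟨∑ i, (![3 * v, 3 * v, 3 * v, 3 * v, 3 * v + 2] : Fin 5 → ℤ) i * generator v i,
    fun x h => ?_⟩
  rw [← Finset.sum_sub_distrib] at h
  simp only [← sub_mul] at h
  have := le_sum_abs_sub_of_inLattice hv ((inLattice_iff v
    (fun i => (![3 * v, 3 * v, 3 * v, 3 * v, 3 * v + 2] : Fin 5 → ℤ) i - x i)).2 h)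
  simp only [Matrix.cons_val, sub_sub_self] at this
  rw [Fin.sum_univ_five]
  linarith

theorem exists_small_representation_zero (z : ℤ) :
    ∃ x : Fin 5 → ℤ, ∑ i, |x i| ≤ 2 ∧ order 0 ∣ z - ∑ i, x i * generator 0 i := by
  have key : ∀ w : Fin 45, ∃ i j : Fin 5, ∃ a b : Fin 3,
      (45 : ℤ) ∣ w - (((a : ℤ) - 1) * generator 0 i + ((b : ℤ) - 1) * generator 0 j) := by
    decide +kernel
  obtain ⟨i, j, a, b, h⟩ := key ⟨(z % 45).toNat, by omega⟩
  have ha : |(a : ℤ) - 1| ≤ 1 := by rw [abs_le]; omega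
  have hb : |(b : ℤ) - 1| ≤ 1 := by rw [abs_le]; omega
  refine ⟨Pi.single i ((a : ℤ) - 1) + Pi.single j ((b : ℤ) - 1), ?_, ?_⟩
  · refine (sum_abs_add_le _ _).trans ?_
    rw [sum_abs_single, sum_abs_single]
    linarith
  · have hs := fun i e => sum_single_mul i e (generator 0)
    simp only [Int.cast_id] at hs
    simp only [Pi.add_apply, add_mul, Finset.sum_add_distrib, hs]
    have h45 : order 0 = 45 := by norm_num [order]
    rw [h45]
    simp only at h
    omega

theorem exists_deep_element_zero :
    ∃ z : ℤ, ∀ x : Fin 5 → ℤ, order 0 ∣ z - ∑ i, x i * generator 0 i → 2 ≤ ∑ i, |x i| := by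
  -- Modulo 45, `2` is neither `0` nor any of `±1, ±3, ±5, ±12, ±19`.
  refine ⟨2, fun x h => ?_⟩
  by_contra! hx
  simp only [Fin.sum_univ_five, generator, order, Matrix.cons_val] at h hx
  norm_num at h
  have a0 := abs_cases (x 0)
  have a1 := abs_cases (x 1)
  have a2 := abs_cases (x 2)
  have a3 := abs_cases (x 3)
  have a4 := abs_cases (x 4)
  have b1 : x 1 = -1 ∨ x 1 = 0 ∨ x 1 = 1 := by omega
  have b2 : x 2 = -1 ∨ x 2 = 0 ∨ x 2 = 1 := by omega
  have b3 : x 3 = -1 ∨ x 3 = 0 ∨ x 3 = 1 := by omega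
  have b4 : x 4 = -1 ∨ x 4 = 0 ∨ x 4 = 1 := by omega
  rcases b1 with b1 | b1 | b1 <;> rcases b2 with b2 | b2 | b2 <;> rcases b3 with b3 | b3 | b3 <;>
  rcases b4 with b4 | b4 | b4 <;> rw [b1, b2, b3, b4] at hx h <;> norm_num at hx <;> omega

theorem generator_pos {v : ℤ} (hv : 0 ≤ v) (i : Fin 5) : 0 < generator v i := by
  fin_cases i <;> simp [generator] <;> positivity

theorem two_mul_generator_lt_order {v : ℤ} (hv : 0 ≤ v) (i : Fin 5) :
    2 * generator v i < order v := by
  fin_cases i <;> simp [generator, order] <;> rw [← sub_pos] <;> ring_nf <;> positivity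

theorem generator_injective {v : ℤ} (hv : 0 ≤ v) : Function.Injective (generator v) := by
  rcases hv.eq_or_lt with rfl | hv
  · decide
  -- For `v ≥ 1` the generators increase, and in `u = v - 1` the differences have nonnegative
  -- coefficients; at `v = 0` they are not in increasing order.
  · obtain ⟨u, hu, rfl⟩ : ∃ u, 0 ≤ u ∧ v = u + 1 := ⟨v - 1, by omega, by ring⟩
    refine (Fin.strictMono_iff_lt_succ.2 fun i => ?_).injective
    fin_cases i <;> simp [generator] <;> rw [← sub_pos] <;> ring_nf <;> positivity

theorem theorem5 (k : ℕ) (hk : k ≡ 2 [MOD 15]) :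
    ∃ (n : ℕ) (g : Fin 5 → ℤ),
      (n : ℚ) = (512 * (k : ℚ) ^ 5 + 1280 * (k : ℚ) ^ 4 + 6080 * (k : ℚ) ^ 3
        + 7840 * (k : ℚ) ^ 2 + 10010 * (k : ℚ) + 3741) / 3125 ∧
      g 0 = 1 ∧
      (g 1 : ℚ) = (128 * (k : ℚ) ^ 4 + 256 * (k : ℚ) ^ 3 + 1192 * (k : ℚ) ^ 2
        + 1064 * (k : ℚ) + 883) / 625 ∧
      (g 2 : ℚ) = (512 * (k : ℚ) ^ 5 + 640 * (k : ℚ) ^ 4 + 4000 * (k : ℚ) ^ 3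
        - 1320 * (k : ℚ) ^ 2 - 6660 * (k : ℚ) - 11899) / 9375 ∧
      (g 3 : ℚ) = (512 * (k : ℚ) ^ 5 + 640 * (k : ℚ) ^ 4 + 4000 * (k : ℚ) ^ 3
        - 1320 * (k : ℚ) ^ 2 + 840 * (k : ℚ) - 8149) / 9375 ∧
      (g 4 : ℚ) = (512 * (k : ℚ) ^ 5 + 640 * (k : ℚ) ^ 4 + 6400 * (k : ℚ) ^ 3
        + 2280 * (k : ℚ) ^ 2 + 13890 * (k : ℚ) - 2224) / 9375 ∧
      AddSubgroup.closure (Set.range fun i => (g i : ZMod n)) = ⊤ ∧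
      Nat.card (ZMod n) = n ∧
      (∀ v : ZMod n, ((circulantOnFive n g).neighborSet v).ncard = 10) ∧
      (circulantOnFive n g).Connected ∧
      (circulantOnFive n g).diam = k := by
  obtain ⟨v, rfl⟩ : ∃ v, k = 15 * v + 2 := ⟨k / 15, by unfold Nat.ModEq at hk; omega⟩
  have hv : (0 : ℤ) ≤ v := Int.natCast_nonneg v
  have hn : ((order v).toNat : ℤ) = order v :=
    Int.toNat_of_nonneg (by rw [order]; positivity)
  refine ⟨(order v).toNat, generator v, ?_, rfl, ?_, ?_, ?_, ?_, closure_eq_top_of_eq_one rfl,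
    Nat.card_zmod _, ncard_neighborSet_circulantOnFive (generator_injective hv) (generator_pos hv)
      (fun i => by rw [hn]; exact two_mul_generator_lt_order hv i), ?_⟩
  · rw [← Int.cast_natCast, hn, order]; push_cast; ring
  · simp [generator]; ring
  · simp [generator]; ring
  · simp [generator]; ring
  · simp [generator]; ring
  · apply connected_and_diam_eq <;> rw [hn] <;> push_cast <;>
      rcases Nat.eq_zero_or_pos v with rfl | h
    · exact exists_small_representation_zero
    · exact exists_small_representation (by exact_mod_cast h)
    · exact exists_deep_element_zero
    · exact exists_deep_element (by exact_mod_cast h)
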